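/- Let $K:\mathbb R^{n_x}\to\mathbb R$ be a closed (lower semicontinuous) convex function, let $M\in\mathbb R^{n_s\times n_x}$ and $s\in\mathbb R^{n_s}$, and suppose that $x\mapsto K(x)+\|Mx\|^2$ is strictly convex, where $\|\cdot\|$ is the Euclidean norm. Let $\lambda>0$, let $x^0\in\mathbb R^{n_x}$ and $\mu^0\in\mathbb R^{n_s}$ be arbitrary, and let $\nu_k\ge 0$ $(k\ge 0)$ satisfy $\sum_{k=0}^\infty\nu_k<+\infty$. Let $\{x^k\}\subset\mathbb R^{n_x}$ and $\{\mu^k\}\subset\mathbb R^{n_s}$ be sequences starting at $x^0$ and $\mu^0$ such that, for every $k\ge 0$, (i) the function $x\mapsto K(x)-\langle\mu^k,Mx\rangle+\frac{\lambda}{2}\|Mx-s\|^2$ has a (necessarily unique) minimizer $\bar x^k$ over $\mathbb R^{n_x}$, and $\|x^{k+1}-\bar x^k\|<\nu_k$; (ii) $\mu^{k+1}=\mu^k+\lambda(s-Mx^{k+1})$. Consider the Lagrangian $\mathcal L(x,\mu)=K(x)-\langle\mu,Mx-s\rangle$; a saddle point of $\mathcal L$ is a pair $(\hat x,\hat\mu)$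 with $\mathcal L(\hat x,\mu)\le\mathcal L(\hat x,\hat\mu)\le\mathcal L(x,\hat\mu)$ for all $x\in\mathbb R^{n_x}$ and $\mu\in\mathbb R^{n_s}$. If $\mathcal L$ has a saddle point, then there is a saddle point $(\hat x,\hat\mu)$ of $\mathcal L$ such that $x^k\to\hat x$ and $\mu^k\to\hat\mu$. If $\mathcal L$ has no saddle point, then at least one of the sequences $\{x^k\}$ and $\{\mu^k\}$ is unbounded. -/

import Mathlib

/-- The Lagrangian `L(x, μ) = K(x) - ⟨μ, M x - s⟩` of the problem
`min K(x)` subject to `M x = s`. -/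
noncomputable def lagrangian {ns nx : ℕ} (K : EuclideanSpace ℝ (Fin nx) → ℝ)
    (M : Matrix (Fin ns) (Fin nx) ℝ) (s : EuclideanSpace ℝ (Fin ns))
    (x : EuclideanSpace ℝ (Fin nx)) (μ : EuclideanSpace ℝ (Fin ns)) : ℝ :=
  K x - inner ℝ μ (M.toEuclideanLin x - s)

/-- The objective `K(x) - ⟨μ, M x⟩ + (lam / 2) ‖M x - s‖²` of the augmented Lagrangian
subproblem with multiplier `μ`. -/
noncomputable def augLagObjective {ns nx : ℕ} (K : EuclideanSpace ℝ (Fin nx) → ℝ)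
    (M : Matrix (Fin ns) (Fin nx) ℝ) (s : EuclideanSpace ℝ (Fin ns)) (lam : ℝ)
    (μ : EuclideanSpace ℝ (Fin ns)) (x : EuclideanSpace ℝ (Fin nx)) : ℝ :=
  K x - inner ℝ μ (M.toEuclideanLin x) + lam / 2 * ‖M.toEuclideanLin x - s‖ ^ 2

/-!
The inexact method of multipliers is the inexact proximal point method on the dual problem.

Let `p k` be the exact minimizer of the `k`-th subproblem and `q k = μ k + λ (s - M (p k))` the
multiplier it would produce. Optimality says that `p k` minimizes the ordinary Lagrangian with
multiplier `q k` (`lagrangian_le_of_isMinOn_augmented`), and `‖μ (k + 1) - q k‖ ≤ λ ‖M‖ ν k` is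
summable.

If a saddle point `(x̂, m)` exists, comparing this with the optimality of `x̂` gives
`‖q k - m‖² + ‖q k - μ k‖² ≤ ‖μ k - m‖²`. So `‖μ k - m‖` converges and the residuals
`M (p k) - s` tend to zero. Then `p k` is a minimizing sequence of
`K(x) - ⟨m, M x - s⟩ + ‖M x - s‖²`, whose unique minimizer is `x̂` by strict convexity, and
in finite dimension this forces `p k → x̂`. Every cluster point `m'` of `μ k` is again an optimal
multiplier, and since `‖μ k - m'‖` converges too, `μ k → m'` (`IsKKTPair.exists_tendsto`).

If both sequences are bounded, a saddle point is obtained as a cluster point of the running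
averages of `(p k, q k)`: in the sum of the optimality conditions the terms
`⟨q k, s - M (p k)⟩ = λ⁻¹ ⟨q k, q k - μ k⟩` are bounded below by a telescoping sum with summable
errors (`exists_isKKTPair_of_bounded`).
-/

open Filter Topology

section AugmentedLagrangian

variable {E F : Type*} [NormedAddCommGroup E] [InnerProductSpace ℝ E]
  [NormedAddCommGroup F] [InnerProductSpace ℝ F]

/-- `IsKKTPair K A s x m`: the point `x` is feasible for `min K(x)` subject to `A x = s`, and it
minimizes the Lagrangian with multiplier `m`. This is the saddle point condition with the
maximization over multipliers carried out. -/
def IsKKTPair (K : E → ℝ) (A : E →L[ℝ] F) (s : F) (x : E) (m : F) : Prop :=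
  A x = s ∧ ∀ y, K x ≤ K y - inner ℝ m (A y - s)

/-! ### One step of the method -/

/-- First-order optimality for the augmented Lagrangian subproblem: with the exact multiplier
update `μ + c • (s - A p)`, the minimizer `p` also minimizes the ordinary Lagrangian. The
quadratic term enters only to second order along segments issuing from `p`. -/
theorem lagrangian_le_of_isMinOn_augmented {K : E → ℝ} (hK : ConvexOn ℝ Set.univ K)
    (A : E →L[ℝ] F) (s μ : F) {c : ℝ} (hc : 0 < c) {p : E}
    (hp : ∀ y, K p - inner ℝ μ (A p) + c / 2 * ‖A p - s‖ ^ 2 ≤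
      K y - inner ℝ μ (A y) + c / 2 * ‖A y - s‖ ^ 2) (y : E) :
    K p + inner ℝ (μ + c • (s - A p)) (A y - A p) ≤ K y := by
  set d := A y - A p with hd
  set D := K y - K p - inner ℝ (μ + c • (s - A p)) d with hD
  set C := c / 2 * ‖d‖ ^ 2 with hC
  have hC0 : 0 ≤ C := by positivity
  have key : ∀ t : ℝ, 0 < t → t ≤ 1 → 0 ≤ D + t * C := by
    intro t ht ht1
    have h1 := hK.2 (Set.mem_univ p) (Set.mem_univ y) (sub_nonneg.2 ht1) ht.le (by ring)
    have h2 := hp ((1 - t) • p + t • y)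
    have hA : A ((1 - t) • p + t • y) = A p + t • d := by
      rw [hd, map_add, map_smul, map_smul]; module
    have hA' : A p + t • d - s = (A p - s) + t • d := by abel
    rw [hA, hA', norm_add_sq_real, inner_add_right, inner_smul_right, inner_smul_right, norm_smul,
      Real.norm_of_nonneg ht.le] at h2
    have h3 : inner ℝ (μ + c • (s - A p)) d = inner ℝ μ d - c * inner ℝ (A p - s) d := by
      rw [inner_add_left, inner_smul_left, ← neg_sub (A p) s, inner_neg_left]
      simp; ring
    simp only [smul_eq_mul] at h1
    rw [hD, hC, h3]
    refine nonneg_of_mul_nonneg_right (a := t) ?_ ht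
    linear_combination h1 + h2
  by_contra hcon
  have hneg : D < 0 := by rw [hD]; linarith
  have hpos : 0 < C - D := by linarith
  have h := key (-D / (C - D)) (div_pos (by linarith) hpos) ((div_le_one hpos).2 (by linarith))
  have h' : D + -D / (C - D) * C = -(D ^ 2 / (C - D)) := by field_simp; ring
  rw [h'] at h
  have : 0 < D ^ 2 / (C - D) := div_pos (sq_pos_of_neg hneg) hpos
  linarith

/-- The exact multiplier update is a proximal step on the dual, hence firmly nonexpansive towards
every optimal multiplier. -/
theorem norm_sq_add_norm_sq_le_of_isKKTPair {K : E → ℝ} {A : E →L[ℝ] F} {s : F} {x : E} {m : F}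
    (h : IsKKTPair K A s x m) {c : ℝ} (hc : 0 < c) {p : E} {q μ : F}
    (hq : q = μ + c • (s - A p))
    (hp : ∀ y, K p + inner ℝ q (A y - A p) ≤ K y) :
    ‖q - m‖ ^ 2 + ‖q - μ‖ ^ 2 ≤ ‖μ - m‖ ^ 2 := by
  have h1 := hp x
  have h2 := h.2 p
  rw [h.1] at h1
  have h3 : q - μ = c • (s - A p) := by rw [hq]; abel
  have h4 : inner ℝ (q - m) (s - A p) ≤ 0 := by
    rw [inner_sub_left]
    rw [← neg_sub s (A p), inner_neg_right] at h2
    linarith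
  have h5 : inner ℝ (q - m) (q - μ) ≤ 0 := by
    rw [h3, inner_smul_right]
    exact mul_nonpos_of_nonneg_of_nonpos hc.le h4
  have h6 : μ - m = (q - m) - (q - μ) := by abel
  rw [h6, norm_sub_sq_real (q - m) (q - μ)]
  linarith

/-! ### Quasi-Fejér monotone sequences -/

/-- A nonnegative sequence that decreases up to summable errors converges. -/
theorem exists_tendsto_of_le_add_summable {a ε : ℕ → ℝ} (ha : ∀ k, 0 ≤ a k)
    (hε : Summable ε) (h : ∀ k, a (k + 1) ≤ a k + ε k) : ∃ l, Tendsto a atTop (𝓝 l) := by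
  have hsum := hε.hasSum.tendsto_sum_nat
  have hanti : Antitone fun n => a n - ∑ i ∈ Finset.range n, ε i := by
    refine antitone_nat_of_succ_le fun n => ?_
    rw [Finset.sum_range_succ]
    linarith [h n]
  obtain ⟨B, hB⟩ := hsum.bddAbove_range
  have hbdd : BddBelow (Set.range fun n => a n - ∑ i ∈ Finset.range n, ε i) := by
    refine ⟨-B, ?_⟩
    rintro _ ⟨n, rfl⟩
    have := hB ⟨n, rfl⟩
    dsimp only at this ⊢
    linarith [ha n]
  refine ⟨_, ((tendsto_atTop_ciInf hanti hbdd).add hsum).congr fun n => ?_⟩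
  ring

/-- Inexact multiplier updates with summable errors: the distance to an optimal multiplier
converges, and the exact steps tend to zero. -/
theorem tendsto_norm_sub_of_fejer {G : Type*} [NormedAddCommGroup G] {μ q : ℕ → G} {ε : ℕ → ℝ}
    (hε : Summable ε)
    (herr : ∀ k, ‖μ (k + 1) - q k‖ ≤ ε k) {m : G}
    (h : ∀ k, ‖q k - m‖ ^ 2 + ‖q k - μ k‖ ^ 2 ≤ ‖μ k - m‖ ^ 2) :
    (∃ l, Tendsto (fun k => ‖μ k - m‖) atTop (𝓝 l)) ∧
      Tendsto (fun k => q k - μ k) atTop (𝓝 0) := by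
  have hle : ∀ k, ‖q k - m‖ ≤ ‖μ k - m‖ := fun k =>
    (sq_le_sq₀ (norm_nonneg _) (norm_nonneg _)).1 (by linarith [h k, sq_nonneg ‖q k - μ k‖])
  have hge : ∀ k, ‖μ (k + 1) - m‖ - ε k ≤ ‖q k - m‖ := fun k => by
    have := norm_add_le (μ (k + 1) - q k) (q k - m)
    rw [sub_add_sub_cancel] at this
    linarith [herr k]
  obtain ⟨l, hl⟩ := exists_tendsto_of_le_add_summable (fun k => norm_nonneg (μ k - m)) hε
    fun k => by linarith [hle k, hge k]
  refine ⟨⟨l, hl⟩, ?_⟩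
  have hq : Tendsto (fun k => ‖q k - m‖) atTop (𝓝 l) := by
    refine tendsto_of_tendsto_of_tendsto_of_le_of_le ?_ hl hge hle
    simpa using (hl.comp (tendsto_add_atTop_nat 1)).sub hε.tendsto_atTop_zero
  have hdiff : Tendsto (fun k => ‖μ k - m‖ ^ 2 - ‖q k - m‖ ^ 2) atTop (𝓝 0) := by
    simpa using (hl.pow 2).sub (hq.pow 2)
  have hsq : Tendsto (fun k => ‖q k - μ k‖ ^ 2) atTop (𝓝 0) :=
    squeeze_zero (fun k => by positivity) (fun k => by linarith [h k]) hdiff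
  have := hsq.sqrt
  simp only [Real.sqrt_sq (norm_nonneg _), Real.sqrt_zero] at this
  exact tendsto_zero_iff_norm_tendsto_zero.2 this

/-! ### Primal convergence -/

/-- In finite dimension, minimizing sequences of a convex function with a unique minimizer
converge to it: the function exceeds its minimum by a fixed amount on every sphere around the
minimizer, hence by convexity also outside the sphere. -/
theorem tendsto_of_tendsto_unique_min [FiniteDimensional ℝ E] {g : E → ℝ}
    (hg : ConvexOn ℝ Set.univ g) {x : E} (hx : ∀ y, y ≠ x → g x < g y) {p : ℕ → E}
    (hp : ∀ δ > 0, ∀ᶠ k in atTop, g (p k) < g x + δ) : Tendsto p atTop (𝓝 x) := by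
  have hcont : Continuous g :=
    continuousOn_univ.1 (hg.continuousOn isOpen_univ)
  refine Metric.tendsto_atTop'.2 fun r hr => ?_
  suffices ∃ δ > 0, ∀ z, r ≤ dist z x → g x + δ ≤ g z by
    obtain ⟨δ, hδ, hz⟩ := this
    obtain ⟨N, hN⟩ := eventually_atTop.1 (hp δ hδ)
    refine ⟨N, fun n hn => ?_⟩
    by_contra hcon
    linarith [hz _ (not_lt.1 hcon), hN n hn.le]
  have hproj : ∀ z, r ≤ dist z x → ∃ w ∈ Metric.sphere x r, g w ≤ g z := by
    intro z hz
    have hpos : 0 < ‖z - x‖ := by rw [← dist_eq_norm]; linarith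
    have ht1 : r / ‖z - x‖ ≤ 1 := by rw [div_le_one hpos, ← dist_eq_norm]; exact hz
    have ht0 : 0 ≤ r / ‖z - x‖ := by positivity
    refine ⟨(1 - r / ‖z - x‖) • x + (r / ‖z - x‖) • z, ?_, ?_⟩
    · have : (1 - r / ‖z - x‖) • x + (r / ‖z - x‖) • z - x = (r / ‖z - x‖) • (z - x) := by module
      rw [mem_sphere_iff_norm, this, norm_smul, Real.norm_of_nonneg ht0]
      field_simp
    · have h1 := hg.2 (Set.mem_univ x) (Set.mem_univ z) (sub_nonneg.2 ht1) ht0 (by ring)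
      have h2 : g x ≤ g z := by
        rcases eq_or_ne z x with rfl | hne
        · exact le_rfl
        · exact (hx z hne).le
      simp only [smul_eq_mul] at h1
      nlinarith [mul_le_mul_of_nonneg_left h2 (sub_nonneg.2 ht1)]
  rcases (Metric.sphere x r).eq_empty_or_nonempty with hemp | hne
  -- In dimension zero the sphere is empty, and so is its exterior.
  · refine ⟨1, one_pos, fun z hz => ?_⟩
    obtain ⟨w, hw, -⟩ := hproj z hz
    simp [hemp] at hw
  · obtain ⟨w, hw, hmin⟩ := (isCompact_sphere x r).exists_isMinOn hne hcont.continuousOn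
    have hwx : w ≠ x := by
      rintro rfl
      rw [mem_sphere_iff_norm, sub_self, norm_zero] at hw
      exact hr.ne hw
    refine ⟨g w - g x, sub_pos.2 (hx w hwx), fun z hz => ?_⟩
    obtain ⟨v, hv, hvz⟩ := hproj z hz
    have : g w ≤ g v := hmin hv
    linarith

/-- The strict convexity assumption enters here: the Lagrangian at an optimal multiplier,
augmented by the squared residual, has the optimal point as its only minimizer. -/
theorem IsKKTPair.lt_augmented {K : E → ℝ} {A : E →L[ℝ] F} {s : F} {x : E} {m : F}
    (h : IsKKTPair K A s x m) (hKA : StrictConvexOn ℝ Set.univ fun y => K y + ‖A y‖ ^ 2)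
    {y : E} (hy : y ≠ x) : K x < K y - inner ℝ m (A y - s) + ‖A y - s‖ ^ 2 := by
  have h1 := h.2 y
  by_contra hcon
  have hsq : ‖A y - s‖ ^ 2 = 0 := le_antisymm (by linarith) (by positivity)
  have hAy : A y = s := by simpa [sub_eq_zero] using hsq
  have hKy : K y ≤ K x := by simpa [hAy] using hcon
  have hmid := hKA.2 (Set.mem_univ y) (Set.mem_univ x) hy
    (one_half_pos (α := ℝ)) (one_half_pos (α := ℝ)) (by norm_num)
  have hA : A ((1 / 2 : ℝ) • y + (1 / 2 : ℝ) • x) = s := by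
    rw [map_add, map_smul, map_smul, hAy, h.1, ← add_smul]; norm_num
  have h2 := h.2 ((1 / 2 : ℝ) • y + (1 / 2 : ℝ) • x)
  rw [hA, sub_self, inner_zero_right] at h2
  simp only [hA, hAy, h.1, smul_eq_mul] at hmid
  linarith

theorem convexOn_augmented {K : E → ℝ} (hK : ConvexOn ℝ Set.univ K) (A : E →L[ℝ] F) (s m : F) :
    ConvexOn ℝ Set.univ fun y => K y - inner ℝ m (A y - s) + ‖A y - s‖ ^ 2 := by
  refine ⟨convex_univ, fun y _ z _ a b ha hb hab => ?_⟩
  have h1 := hK.2 (Set.mem_univ y) (Set.mem_univ z) ha hb hab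
  have hA : A (a • y + b • z) - s = a • (A y - s) + b • (A z - s) := by
    have : s = (a + b) • s := by rw [hab, one_smul]
    rw [map_add, map_smul, map_smul]
    nth_rw 1 [this]
    module
  have h2 : ‖a • (A y - s) + b • (A z - s)‖ ^ 2 ≤ a * ‖A y - s‖ ^ 2 + b * ‖A z - s‖ ^ 2 := by
    have h3 : ‖a • (A y - s) + b • (A z - s)‖ ≤ a * ‖A y - s‖ + b * ‖A z - s‖ := by
      refine (norm_add_le _ _).trans_eq ?_
      rw [norm_smul, norm_smul, Real.norm_of_nonneg ha, Real.norm_of_nonneg hb]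
    have h4 := (convexOn_pow 2).2 (norm_nonneg (A y - s)) (norm_nonneg (A z - s)) ha hb hab
    simp only [smul_eq_mul] at h4
    exact (pow_le_pow_left₀ (norm_nonneg _) h3 2).trans h4
  simp only [smul_eq_mul] at h1 ⊢
  rw [hA, inner_add_right, inner_smul_right, inner_smul_right]
  linear_combination h1 + h2

/-! ### Convergence when a saddle point exists -/

/-- Convergence of the exact subproblem minimizers `p k` and of the inexact multipliers `μ k`,
given one KKT pair. The primal limit is the given `x`, the multiplier limit in general is not
the given one. -/
theorem IsKKTPair.exists_tendsto [FiniteDimensional ℝ E] [FiniteDimensional ℝ F] {K : E → ℝ}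
    {A : E →L[ℝ] F} {s : F} {x : E} {m : F} (h : IsKKTPair K A s x m)
    (hK : ConvexOn ℝ Set.univ K)
    (hKA : StrictConvexOn ℝ Set.univ fun y => K y + ‖A y‖ ^ 2) {c : ℝ} (hc : 0 < c)
    {p : ℕ → E} {q μ : ℕ → F} {ε : ℕ → ℝ} (hε : Summable ε)
    (hq : ∀ k, q k = μ k + c • (s - A (p k)))
    (hp : ∀ k y, K (p k) + inner ℝ (q k) (A y - A (p k)) ≤ K y)
    (herr : ∀ k, ‖μ (k + 1) - q k‖ ≤ ε k) :
    ∃ m', IsKKTPair K A s x m' ∧ Tendsto p atTop (𝓝 x) ∧ Tendsto μ atTop (𝓝 m') := by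
  have : ProperSpace F := FiniteDimensional.proper ℝ F
  have hfejer : ∀ m', IsKKTPair K A s x m' →
      (∃ l, Tendsto (fun k => ‖μ k - m'‖) atTop (𝓝 l)) ∧
        Tendsto (fun k => q k - μ k) atTop (𝓝 0) := fun m' h' =>
    tendsto_norm_sub_of_fejer hε herr fun k =>
      norm_sq_add_norm_sq_le_of_isKKTPair h' hc (hq k) (hp k)
  obtain ⟨⟨l, hl⟩, hqμ⟩ := hfejer m h
  have hres : Tendsto (fun k => A (p k) - s) atTop (𝓝 0) := by
    have := hqμ.const_smul (-c⁻¹)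
    rw [smul_zero] at this
    refine this.congr fun k => ?_
    rw [hq k, add_sub_cancel_left, smul_smul, neg_mul, inv_mul_cancel₀ hc.ne']
    module
  obtain ⟨B, hB⟩ := hl.bddAbove_range
  have hμB : ∀ k, μ k ∈ Metric.closedBall m B := fun k => by
    rw [mem_closedBall_iff_norm]; exact hB ⟨k, rfl⟩
  have hptend : Tendsto p atTop (𝓝 x) := by
    refine tendsto_of_tendsto_unique_min (convexOn_augmented hK A s m)
      (x := x) (fun y hy => by simpa [h.1] using h.lt_augmented hKA hy) fun δ hδ => ?_
    -- The value at `p k` exceeds the minimum by at most `⟪q k - m, r⟫ + ‖r‖²`, `r = A (p k) - s`.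
    have hup : Tendsto (fun k => (‖q k - μ k‖ + B) * ‖A (p k) - s‖ + ‖A (p k) - s‖ ^ 2) atTop
        (𝓝 0) := by
      simpa using ((hqμ.norm.add_const B).mul hres.norm).add (hres.norm.pow 2)
    filter_upwards [hup.eventually (gt_mem_nhds hδ)] with k hk
    have h1 := hp k x
    rw [h.1, ← neg_sub (A (p k)) s, inner_neg_right] at h1
    have h2 : inner ℝ (q k - m) (A (p k) - s) ≤ (‖q k - μ k‖ + B) * ‖A (p k) - s‖ := by
      refine (real_inner_le_norm _ _).trans (mul_le_mul_of_nonneg_right ?_ (norm_nonneg _))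
      have := norm_add_le (q k - μ k) (μ k - m)
      rw [sub_add_sub_cancel] at this
      linarith [mem_closedBall_iff_norm.1 (hμB k)]
    rw [inner_sub_left] at h2
    simp only [h.1, sub_self, inner_zero_right, norm_zero]
    linarith
  obtain ⟨m', -, φ, hφ, hφm⟩ := tendsto_subseq_of_bounded Metric.isBounded_closedBall hμB
  have hqφ : Tendsto (fun k => q (φ k)) atTop (𝓝 m') := by
    simpa using (hqμ.comp hφ.tendsto_atTop).add hφm
  have hKcont : Continuous K :=
    continuousOn_univ.1 (hK.continuousOn isOpen_univ)
  have hm' : IsKKTPair K A s x m' := by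
    refine ⟨h.1, fun y => ?_⟩
    have hpφ := hptend.comp hφ.tendsto_atTop
    have hlim := ((hKcont.tendsto x).comp hpφ).add
      (hqφ.inner (𝕜 := ℝ) (((A.continuous.tendsto x).comp hpφ).const_sub (A y)))
    have := le_of_tendsto' hlim fun k => hp (φ k) y
    rw [h.1] at this
    linarith
  refine ⟨m', hm', hptend, ?_⟩
  obtain ⟨⟨l', hl'⟩, -⟩ := hfejer m' hm'
  have hzero : Tendsto (fun k => ‖μ (φ k) - m'‖) atTop (𝓝 0) := by
    simpa using (hφm.sub_const m').norm
  rw [tendsto_nhds_unique (hl'.comp hφ.tendsto_atTop) hzero] at hl'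
  exact tendsto_iff_norm_sub_tendsto_zero.2 hl'

/-! ### Boundedness yields a saddle point -/

theorem norm_average_le {f : ℕ → E} {R : ℝ} (h : ∀ k, ‖f k‖ ≤ R) (n : ℕ) :
    ‖∑ i ∈ Finset.range (n + 1), ((n : ℝ) + 1)⁻¹ • f i‖ ≤ R := by
  have hn : (0 : ℝ) < n + 1 := by positivity
  rw [← Finset.smul_sum, norm_smul, Real.norm_of_nonneg (by positivity)]
  have : ‖∑ i ∈ Finset.range (n + 1), f i‖ ≤ (n + 1) * R := by
    refine (norm_sum_le _ _).trans ((Finset.sum_le_sum fun i _ => h i).trans_eq ?_)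
    simp
  rw [inv_mul_le_iff₀ hn]
  exact this

/-- If the iterates stay bounded, every cluster point of the running averages of `(p k, q k)` is
a KKT pair: summing the optimality conditions of the subproblems makes the multiplier terms
telescope, up to summable errors, and division by the number of steps removes them. -/
theorem exists_isKKTPair_of_bounded [FiniteDimensional ℝ E] [FiniteDimensional ℝ F] {K : E → ℝ}
    {A : E →L[ℝ] F} {s : F} (hK : ConvexOn ℝ Set.univ K) {c : ℝ} (hc : 0 < c)
    {p : ℕ → E} {q μ : ℕ → F} {ε : ℕ → ℝ} (hε : Summable ε)
    (hq : ∀ k, q k = μ k + c • (s - A (p k)))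
    (hp : ∀ k y, K (p k) + inner ℝ (q k) (A y - A (p k)) ≤ K y)
    (herr : ∀ k, ‖μ (k + 1) - q k‖ ≤ ε k)
    {R B : ℝ} (hpR : ∀ k, ‖p k‖ ≤ R) (hμB : ∀ k, ‖μ k‖ ≤ B) :
    ∃ x m, IsKKTPair K A s x m := by
  have : ProperSpace E := FiniteDimensional.proper ℝ E
  have : ProperSpace F := FiniteDimensional.proper ℝ F
  have hε0 : ∀ k, 0 ≤ ε k := fun k => (norm_nonneg _).trans (herr k)
  have hB0 : 0 ≤ B := (norm_nonneg _).trans (hμB 0)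
  set S := ∑' k, ε k
  have hS : ∀ n, ∑ i ∈ Finset.range n, ε i ≤ S := fun n =>
    hε.sum_le_tsum _ fun i _ => hε0 i
  have hεS : ∀ k, ε k ≤ S := fun k => hε.le_tsum k fun i _ => hε0 i
  have hqB : ∀ k, ‖q k‖ ≤ B + S := fun k => by
    have := norm_sub_le (μ (k + 1)) (μ (k + 1) - q k)
    rw [sub_sub_cancel] at this
    linarith [hμB (k + 1), herr k, hεS k]
  have hres : ∀ k, A (p k) - s = c⁻¹ • (μ k - q k) := fun k => by
    rw [hq k, sub_add_cancel_left, smul_neg, smul_smul, inv_mul_cancel₀ hc.ne']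
    module
  -- The averages, and the inequality obtained by averaging the optimality conditions.
  set X : ℕ → E := fun n => ∑ i ∈ Finset.range (n + 1), ((n : ℝ) + 1)⁻¹ • p i with hX
  set Q : ℕ → F := fun n => ∑ i ∈ Finset.range (n + 1), ((n : ℝ) + 1)⁻¹ • q i with hQ
  have hsumw : ∀ n : ℕ, ∑ _i ∈ Finset.range (n + 1), ((n : ℝ) + 1)⁻¹ = 1 := fun n => by
    have hn : (n : ℝ) + 1 ≠ 0 := by positivity
    simp [hn]
  have hstep : ∀ k y, K (p k) + (2 * c)⁻¹ * (‖μ (k + 1)‖ ^ 2 - ‖μ k‖ ^ 2 - 2 * B * ε k) ≤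
      K y - inner ℝ (q k) (A y - s) := by
    intro k y
    have h1 := hp k y
    have h2 : A y - A (p k) = (A y - s) + c⁻¹ • (q k - μ k) := by
      rw [← neg_sub (μ k) (q k), smul_neg, ← hres k]; abel
    rw [h2, inner_add_right, inner_smul_right] at h1
    have h3 : ‖μ (k + 1)‖ ^ 2 - ‖μ k‖ ^ 2 - 2 * B * ε k ≤ 2 * inner ℝ (q k) (q k - μ k) := by
      have e1 := norm_sub_sq_real (q k) (q k - μ k)
      have e2 := norm_sub_sq_real (μ (k + 1)) (μ (k + 1) - q k)
      rw [sub_sub_cancel] at e1 e2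
      have e3 : inner ℝ (μ (k + 1)) (μ (k + 1) - q k) ≤ B * ε k :=
        (real_inner_le_norm _ _).trans
          (mul_le_mul (hμB _) (herr k) (norm_nonneg _) hB0)
      nlinarith [sq_nonneg ‖q k - μ k‖, sq_nonneg ‖μ (k + 1) - q k‖]
    have h4 : (2 * c)⁻¹ * (‖μ (k + 1)‖ ^ 2 - ‖μ k‖ ^ 2 - 2 * B * ε k) ≤
        c⁻¹ * inner ℝ (q k) (q k - μ k) := by
      refine (mul_le_mul_of_nonneg_left h3 (by positivity)).trans_eq ?_
      field_simp
    linarith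
  have havg : ∀ y n, K (X n) - ((n : ℝ) + 1)⁻¹ * ((2 * c)⁻¹ * (B ^ 2 + 2 * B * S)) ≤
      K y - inner ℝ (Q n) (A y - s) := by
    intro y n
    have hn : (0 : ℝ) ≤ ((n : ℝ) + 1)⁻¹ := by positivity
    have h1 : K (X n) ≤ ∑ i ∈ Finset.range (n + 1), ((n : ℝ) + 1)⁻¹ * K (p i) :=
      hK.map_sum_le (fun _ _ => hn) (hsumw n) fun _ _ => Set.mem_univ _
    have h2 : ∑ i ∈ Finset.range (n + 1), ((n : ℝ) + 1)⁻¹ * (K (p i) +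
        (2 * c)⁻¹ * (‖μ (i + 1)‖ ^ 2 - ‖μ i‖ ^ 2 - 2 * B * ε i)) ≤
        ∑ i ∈ Finset.range (n + 1), ((n : ℝ) + 1)⁻¹ * (K y - inner ℝ (q i) (A y - s)) :=
      Finset.sum_le_sum fun i _ => mul_le_mul_of_nonneg_left (hstep i y) hn
    have h3 : ∑ i ∈ Finset.range (n + 1), ((n : ℝ) + 1)⁻¹ * (K y - inner ℝ (q i) (A y - s)) =
        K y - inner ℝ (Q n) (A y - s) := by
      simp only [mul_sub, Finset.sum_sub_distrib, ← Finset.sum_mul, hsumw, one_mul, hQ, sum_inner,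
        real_inner_smul_left]
    have h4 : ∑ i ∈ Finset.range (n + 1), (‖μ (i + 1)‖ ^ 2 - ‖μ i‖ ^ 2 - 2 * B * ε i) =
        ‖μ (n + 1)‖ ^ 2 - ‖μ 0‖ ^ 2 - 2 * B * ∑ i ∈ Finset.range (n + 1), ε i := by
      rw [Finset.sum_sub_distrib, Finset.sum_range_sub (fun i => ‖μ i‖ ^ 2), Finset.mul_sum]
    have h5 : -(B ^ 2 + 2 * B * S) ≤
        ‖μ (n + 1)‖ ^ 2 - ‖μ 0‖ ^ 2 - 2 * B * ∑ i ∈ Finset.range (n + 1), ε i := by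
      have e1 := pow_le_pow_left₀ (norm_nonneg _) (hμB 0) 2
      have e2 := mul_le_mul_of_nonneg_left (hS (n + 1)) (by positivity : 0 ≤ 2 * B)
      have e3 := sq_nonneg ‖μ (n + 1)‖
      linarith
    rw [h3] at h2
    simp only [mul_add, Finset.sum_add_distrib] at h2
    rw [← Finset.mul_sum, ← Finset.mul_sum, ← Finset.mul_sum, h4] at h2
    rw [← Finset.mul_sum] at h1
    have h6 := mul_le_mul_of_nonneg_left
      (mul_le_mul_of_nonneg_left h5 (by positivity : 0 ≤ (2 * c)⁻¹)) hn
    linarith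
  have hnzero : Tendsto (fun n : ℕ => ((n : ℝ) + 1)⁻¹) atTop (𝓝 0) := by
    simpa using tendsto_one_div_add_atTop_nhds_zero_nat (𝕜 := ℝ)
  have hAX : Tendsto (fun n => A (X n)) atTop (𝓝 s) := by
    rw [tendsto_iff_norm_sub_tendsto_zero]
    have hlim := (hnzero.mul_const (c⁻¹ * (2 * B + S)))
    rw [zero_mul] at hlim
    refine squeeze_zero (fun _ => norm_nonneg _) (fun n => ?_) hlim
    have h1 : A (X n) - s = (((n : ℝ) + 1)⁻¹ * c⁻¹) • (μ 0 - μ (n + 1) +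
        ∑ i ∈ Finset.range (n + 1), (μ (i + 1) - q i)) := by
      have e1 : A (X n) - s = ∑ i ∈ Finset.range (n + 1), ((n : ℝ) + 1)⁻¹ • (A (p i) - s) := by
        simp only [smul_sub, Finset.sum_sub_distrib, ← Finset.sum_smul, hsumw, one_smul, hX,
          map_sum, map_smul]
      rw [e1, ← Finset.sum_range_sub' μ, ← Finset.sum_add_distrib, ← Finset.smul_sum, mul_smul,
        Finset.smul_sum (r := c⁻¹)]
      refine congrArg _ (Finset.sum_congr rfl fun i _ => ?_)
      rw [hres i]
      congr 1
      abel
    rw [h1, norm_smul, Real.norm_of_nonneg (by positivity), mul_assoc]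
    refine mul_le_mul_of_nonneg_left (mul_le_mul_of_nonneg_left ?_ (by positivity))
      (by positivity)
    have e2 : ‖∑ i ∈ Finset.range (n + 1), (μ (i + 1) - q i)‖ ≤ S :=
      (norm_sum_le _ _).trans ((Finset.sum_le_sum fun i _ => herr i).trans (hS _))
    have e3 := norm_add_le (μ 0 - μ (n + 1)) (∑ i ∈ Finset.range (n + 1), (μ (i + 1) - q i))
    have e4 := norm_sub_le (μ 0) (μ (n + 1))
    linarith [hμB 0, hμB (n + 1)]
  obtain ⟨⟨x, m⟩, -, φ, hφ, hlim⟩ := tendsto_subseq_of_bounded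
    (s := Metric.closedBall (0 : E) R ×ˢ Metric.closedBall (0 : F) (B + S))
    (Metric.isBounded_closedBall.prod Metric.isBounded_closedBall)
    (x := fun n => (X n, Q n)) fun n =>
      ⟨mem_closedBall_zero_iff.2 (norm_average_le hpR n),
        mem_closedBall_zero_iff.2 (norm_average_le hqB n)⟩
  have hXφ : Tendsto (fun k => X (φ k)) atTop (𝓝 x) := hlim.fst_nhds
  have hQφ : Tendsto (fun k => Q (φ k)) atTop (𝓝 m) := hlim.snd_nhds
  have hKcont : Continuous K :=
    continuousOn_univ.1 (hK.continuousOn isOpen_univ)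
  refine ⟨x, m, tendsto_nhds_unique ((A.continuous.tendsto x).comp hXφ)
    (hAX.comp hφ.tendsto_atTop), fun y => ?_⟩
  have hl := ((hKcont.tendsto x).comp hXφ).sub
    ((hnzero.comp hφ.tendsto_atTop).mul_const ((2 * c)⁻¹ * (B ^ 2 + 2 * B * S)))
  rw [zero_mul, sub_zero] at hl
  exact le_of_tendsto_of_tendsto' hl
    ((hQφ.inner (𝕜 := ℝ) tendsto_const_nhds).const_sub (K y)) fun k => havg y (φ k)

end AugmentedLagrangian

/-! ### The method of multipliers -/

theorem isSaddlePointOn_lagrangian_iff {ns nx : ℕ} (K : EuclideanSpace ℝ (Fin nx) → ℝ)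
    (M : Matrix (Fin ns) (Fin nx) ℝ) (s : EuclideanSpace ℝ (Fin ns))
    (x : EuclideanSpace ℝ (Fin nx)) (m : EuclideanSpace ℝ (Fin ns)) :
    IsSaddlePointOn Set.univ Set.univ (lagrangian K M s) x m ↔
      IsKKTPair K (LinearMap.toContinuousLinearMap M.toEuclideanLin) s x m := by
  simp only [IsSaddlePointOn, IsKKTPair, lagrangian, Set.mem_univ, forall_true_left,
    LinearMap.coe_toContinuousLinearMap']
  refine ⟨fun h => ?_, fun h y μ => ?_⟩
  · have hx : M.toEuclideanLin x = s := by
      -- Moving the multiplier against the residual would increase the Lagrangian.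
      have := h x (m - (M.toEuclideanLin x - s))
      rw [inner_sub_left, real_inner_self_eq_norm_sq] at this
      have hsq : ‖M.toEuclideanLin x - s‖ ^ 2 = 0 := le_antisymm (by linarith) (by positivity)
      simpa [sub_eq_zero] using hsq
    exact ⟨hx, fun y => by simpa [hx] using h y m⟩
  · simpa [h.1] using h.2 y

theorem mainTheorem1 {ns nx : ℕ}
    (K : EuclideanSpace ℝ (Fin nx) → ℝ)
    (M : Matrix (Fin ns) (Fin nx) ℝ) (s : EuclideanSpace ℝ (Fin ns))
    (hKclosed : LowerSemicontinuous K)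
    (hKconvex : ConvexOn ℝ Set.univ K)
    (hKM : StrictConvexOn ℝ Set.univ (fun x => K x + ‖M.toEuclideanLin x‖ ^ 2))
    (lam : ℝ) (hlam : 0 < lam)
    (x : ℕ → EuclideanSpace ℝ (Fin nx)) (μ : ℕ → EuclideanSpace ℝ (Fin ns))
    (ν : ℕ → ℝ) (hν : ∀ k, 0 ≤ ν k) (hνsum : Summable ν)
    (hx : ∀ k, ∃ xbar : EuclideanSpace ℝ (Fin nx),
      IsMinOn (augLagObjective K M s lam (μ k)) Set.univ xbar ∧ ‖x (k + 1) - xbar‖ < ν k)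
    (hμ : ∀ k, μ (k + 1) = μ k + lam • (s - M.toEuclideanLin (x (k + 1)))) :
    ((∃ xhat μhat, IsSaddlePointOn Set.univ Set.univ (lagrangian K M s) xhat μhat) →
      ∃ xhat μhat,
        IsSaddlePointOn Set.univ Set.univ (lagrangian K M s) xhat μhat ∧
        Filter.Tendsto x Filter.atTop (nhds xhat) ∧
        Filter.Tendsto μ Filter.atTop (nhds μhat)) ∧
    ((¬ ∃ xhat μhat, IsSaddlePointOn Set.univ Set.univ (lagrangian K M s) xhat μhat) →
      ¬ Bornology.IsBounded (Set.range x) ∨ ¬ Bornology.IsBounded (Set.range μ)) := by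
  simp only [isSaddlePointOn_lagrangian_iff]
  set A := LinearMap.toContinuousLinearMap M.toEuclideanLin with hA
  have hAM : ∀ y, M.toEuclideanLin y = A y := fun _ => rfl
  simp only [hAM] at hKM hμ
  choose p hpmin hpx using hx
  obtain ⟨q, hq⟩ : ∃ q : ℕ → EuclideanSpace ℝ (Fin ns), ∀ k, q k = μ k + lam • (s - A (p k)) :=
    ⟨_, fun _ => rfl⟩
  have hp : ∀ k y, K (p k) + inner ℝ (q k) (A y - A (p k)) ≤ K y := fun k y => by
    rw [hq k]
    exact lagrangian_le_of_isMinOn_augmented hKconvex A s (μ k) hlam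
      (fun z => hpmin k (Set.mem_univ z)) y
  have herr : ∀ k, ‖μ (k + 1) - q k‖ ≤ lam * ‖A‖ * ν k := fun k => by
    have : μ (k + 1) - q k = -(lam • A (x (k + 1) - p k)) := by
      rw [hμ k, hq k, map_sub]; module
    rw [this, norm_neg, norm_smul, Real.norm_of_nonneg hlam.le, mul_assoc]
    exact mul_le_mul_of_nonneg_left ((A.le_opNorm _).trans
      (mul_le_mul_of_nonneg_left (hpx k).le (norm_nonneg _))) hlam.le
  have hε : Summable fun k => lam * ‖A‖ * ν k := hνsum.mul_left _
  refine ⟨?_, fun hno => ?_⟩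
  · rintro ⟨xhat, μhat, h⟩
    obtain ⟨m, hm, hpt, hμt⟩ := h.exists_tendsto hKconvex hKM hlam hε hq hp herr
    refine ⟨xhat, m, hm, (tendsto_add_atTop_iff_nat 1).1 ?_, hμt⟩
    have hdiff : Tendsto (fun k => x (k + 1) - p k) atTop (𝓝 0) :=
      squeeze_zero_norm (fun k => (hpx k).le) hνsum.tendsto_atTop_zero
    simpa using hdiff.add hpt
  · by_contra! hbdd
    obtain ⟨R, hR⟩ := hbdd.1.exists_norm_le
    obtain ⟨B, hB⟩ := hbdd.2.exists_norm_le
    refine hno (exists_isKKTPair_of_bounded hKconvex hlam hε hq hp herr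
      (R := R + ∑' k, ν k) (B := B) (fun k => ?_) fun k => hB _ ⟨k, rfl⟩)
    have h1 := norm_sub_le (x (k + 1)) (x (k + 1) - p k)
    rw [sub_sub_cancel] at h1
    linarith [hR _ ⟨k + 1, rfl⟩, hpx k, hνsum.le_tsum k fun i _ => hν i]
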